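/- Let $u_\gamma$ be a classical weight on an open interval $\Omega$: $e^{-x^2}$ on $\mathbb R$ (Hermite, $p_2=1$); $x^\alpha e^{-x}$ on $(0,\infty)$ with $\alpha>-1$ (Laguerre, $p_2=x$); or $(1-x)^\alpha(1+x)^\beta$ on $(-1,1)$ with $\alpha,\beta>-1$ (Jacobi, $p_2=1-x^2$). Put $u_{\gamma+r}=p_2^r u_\gamma$ and $\langle g,u_\gamma\rangle=\int_\Omega g\,u_\gamma\,dx$. Call a function $w$ on $\Omega$ of type $\tilde\omega_r$ if $w\in C^r(\Omega)$, the functions $w,w',\dots,w^{(r)}$ have finite (absolutely convergent) moments of all orders on $\Omega$, and for every $t<r$ and every polynomial $f$ one has $w^{(t)}(x)f(x)\to 0$ at both ends of $\Omega$. Let $n\ge 0$ and let $\omega^r_j$ ($0\le r\le n$, $1\le j\le r+1$) be real functions on $\Omega$ such that each $\omega^r_j u_{\gamma+r}$ is of type $\tilde\omega_r$ (when the $\omega^r_j$ are polynomials this holds automatically). Let $\mathscr W=(W_{i,j}\,dx)_{0\le i,j\le n}$ be the symmetric measure matrix with $$W_{i,j}=\omega^{\max(i,j)}_{|i-j|+1}\,u_{\gamma+\max(i,j)},\qquad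 (f,h;\mathscr W)=\sum_{i,j=0}^n\int_\Omega f^{(i)}h^{(j)}W_{i,j}\,dx .$$ 1. There is a linear differential operator $\mathbf F=\sum_{m=0}^{2n}a_m\frac{d^m}{dx^m}$ with coefficients $a_m$ continuous on $\Omega$ such that for all polynomials $f,h$ the functions $\mathbf F[f]\,h\,u_\gamma$ and $f\,\mathbf F[h]\,u_\gamma$ are integrable on $\Omega$ and $$(f,h;\mathscr W)=\langle \mathbf F[f]\,h,u_\gamma\rangle=\langle f\,\mathbf F[h],u_\gamma\rangle .\qquad(*)$$ 2. If all the $\omega^r_j$ are polynomials, there is an $\mathbf F=\sum_{m=0}^{2n}a_m\frac{d^m}{dx^m}$ with polynomial coefficients satisfying $(*)$ for all polynomials $f,h$. 3. Let $\mathbf F=\sum_m a_m\frac{d^m}{dx^m}$ (a finite sum) be any linear differential operator with polynomial coefficients satisfying $(*)$ for all polynomials $f,h$, and let $r=\max\bigl(0,\max_{m:\,a_m\ne0}(\deg a_m-m)\bigr)$. Then $(\mathbf F[f],h;\mathscr W)=(f,\mathbf F[h];\mathscr W)$ for all polynomials $f,h$. If moreover $\mathscr W$ determines a sequence of monic Sobolev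 orthogonal polynomials $(P_{\mathscr W,k})_{k\ge0}$ (that is, $\deg P_{\mathscr W,k}=k$, $(P_{\mathscr W,k},P_{\mathscr W,l};\mathscr W)=0$ for $k\ne l$ and $(P_{\mathscr W,k},P_{\mathscr W,k};\mathscr W)\neq0$), and $(P_{\gamma,k})_{k\ge0}$ are the monic orthogonal polynomials of $u_\gamma$, then there are real constants $\alpha_{k,j},\beta_{k,j}$ such that for all $k\ge 0$ $$\mathbf F[P_{\mathscr W,k}]=\sum_{j=k}^{k+r}\alpha_{k,j}P_{\gamma,j},\qquad \mathbf F[P_{\mathscr W,k}]=\sum_{j=\max(0,k-r)}^{k+r}\beta_{k,j}P_{\mathscr W,j}.$$ -/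

import Mathlib

open Polynomial

/-- The classical families, with their parameters `γ`. -/
inductive ClassicalWeight where
  | hermite : ClassicalWeight
  | laguerre (α : ℝ) : ClassicalWeight
  | jacobi (α β : ℝ) : ClassicalWeight

namespace ClassicalWeight

/-- The admissible parameters: `α > -1` (Laguerre), `α, β > -1` (Jacobi). -/
def Admissible : ClassicalWeight → Prop
  | hermite => True
  | laguerre α => -1 < α
  | jacobi α β => -1 < α ∧ -1 < β

/-- The (open) interval `Ω` that carries the weight. -/
def support : ClassicalWeight → Set ℝ
  | hermite => Set.univ
  | laguerre _ => Set.Ioi 0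
  | jacobi _ _ => Set.Ioo (-1) 1

/-- "`x` tends to the left endpoint of `Ω`, from inside `Ω`". -/
def leftEnd : ClassicalWeight → Filter ℝ
  | hermite => Filter.atBot
  | laguerre _ => nhdsWithin 0 (Set.Ioi 0)
  | jacobi _ _ => nhdsWithin (-1) (Set.Ioi (-1))

/-- "`x` tends to the right endpoint of `Ω`, from inside `Ω`". -/
def rightEnd : ClassicalWeight → Filter ℝ
  | hermite => Filter.atTop
  | laguerre _ => Filter.atTop
  | jacobi _ _ => nhdsWithin 1 (Set.Iio 1)

/-- The weight function `u_γ`; it is only ever used on `Ω`. -/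
noncomputable def u : ClassicalWeight → ℝ → ℝ
  | hermite => fun x => Real.exp (-x ^ 2)
  | laguerre α => fun x => x ^ α * Real.exp (-x)
  | jacobi α β => fun x => (1 - x) ^ α * (1 + x) ^ β

/-- The polynomial `p₂` of the Pearson equation `p₂ u_γ' = p₁ u_γ`. -/
noncomputable def p₂ : ClassicalWeight → ℝ[X]
  | hermite => 1
  | laguerre _ => X
  | jacobi _ _ => 1 - X ^ 2

/-- The shifted parameters `γ + k`. -/
noncomputable def shift : ClassicalWeight → ℕ → ClassicalWeight
  | hermite, _ => hermite
  | laguerre α, k => laguerre (α + k)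
  | jacobi α β, k => jacobi (α + k) (β + k)

/-- `u_{γ+k} = p₂ ^ k u_γ` on `Ω`. -/
theorem u_shift (c : ClassicalWeight) (k : ℕ) {x : ℝ} (hx : x ∈ c.support) :
    (c.shift k).u x = c.p₂.eval x ^ k * c.u x := by
  cases c with
  | hermite => simp [shift, u, p₂]
  | laguerre α =>
    have hx' : 0 < x := hx
    simp only [shift, u, p₂, eval_X]
    rw [Real.rpow_add hx', Real.rpow_natCast]
    ring
  | jacobi α β =>
    have h1 : 0 < 1 - x := by linarith [hx.2]
    have h2 : 0 < 1 + x := by linarith [hx.1]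
    simp only [shift, u, p₂, eval_sub, eval_one, eval_pow, eval_X]
    rw [Real.rpow_add h1, Real.rpow_add h2, Real.rpow_natCast, Real.rpow_natCast,
      show (1 : ℝ) - x ^ 2 = (1 - x) * (1 + x) by ring, mul_pow]
    ring

/-- The pairing `⟨g₁ g₂, u_γ⟩ = ∫_Ω g₁ g₂ u_γ dx`. -/
noncomputable def pairing (c : ClassicalWeight) (g₁ g₂ : ℝ → ℝ) : ℝ :=
  ∫ x in c.support, g₁ x * g₂ x * c.u x

/-- A weight `w` on `Ω` is of type `ω̃_k`: it is of class `C^k` on `Ω`, it and its derivatives up to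
order `k` have finite moments, and the boundary terms of `w, w', …, w^(k-1)` vanish, that is
`w^(t) f` tends to `0` at both ends of `Ω` for every polynomial `f` and every `t < k`. -/
structure IsTildeWeight (c : ClassicalWeight) (k : ℕ) (w : ℝ → ℝ) : Prop where
  contDiffOn : ContDiffOn ℝ k w c.support
  moments : ∀ t ≤ k, ∀ m : ℕ,
    MeasureTheory.IntegrableOn (fun x => x ^ m * iteratedDeriv t w x) c.support
  boundary_left : ∀ t < k, ∀ f : ℝ[X],
    Filter.Tendsto (fun x => iteratedDeriv t w x * f.eval x) c.leftEnd (nhds 0)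
  boundary_right : ∀ t < k, ∀ f : ℝ[X],
    Filter.Tendsto (fun x => iteratedDeriv t w x * f.eval x) c.rightEnd (nhds 0)

end ClassicalWeight

/-- The Sobolev bilinear form `(f, h; 𝒲) = ∑_{i,j ≤ n} ∫_Ω f^(i) h^(j) W_{ij} dx` of the measure
matrix with entries `dμ_{ij} = W_{ij} dx`, `0 ≤ i, j ≤ n`. -/
noncomputable def sobolevForm (Ω : Set ℝ) (n : ℕ) (W : ℕ → ℕ → ℝ → ℝ) (f h : ℝ[X]) : ℝ :=
  ∑ i ∈ Finset.range (n + 1), ∑ j ∈ Finset.range (n + 1),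
    ∫ x in Ω, (derivative^[i] f).eval x * (derivative^[j] h).eval x * W i j x

/-- The `r`-th coefficient matrix: it is symmetric and vanishes outside the row and the column of
index `r` of the upper left `(r+1) × (r+1)` corner (indices start at `0`); its last column there is
`(ω^r_{r+1}, ω^r_r, …, ω^r_1)ᵀ`. -/
def coefficientBlock (ω : ℕ → ℕ → ℝ → ℝ) (r i j : ℕ) (x : ℝ) : ℝ :=
  if j = r ∧ i ≤ r then ω r (r + 1 - i) x
  else if i = r ∧ j ≤ r then ω r (r + 1 - j) x
  else 0

/-- The entries of `𝒲 = ∑_{r=0}^n (r-th coefficient matrix) u_{γ+r} dx`. -/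
noncomputable def classicalMeasureMatrix (c : ClassicalWeight) (n : ℕ) (ω : ℕ → ℕ → ℝ → ℝ)
    (i j : ℕ) (x : ℝ) : ℝ :=
  ∑ r ∈ Finset.range (n + 1), coefficientBlock ω r i j x * (c.shift r).u x

/-- `(P_k)` is the sequence of monic orthogonal polynomials of the bilinear form `B`. With
`P_k = ∑_{j ≤ k} S_{kj} x^j` this is the factorization `S G Sᵀ = H` of the moment matrix
`G = (B(x^i, x^j))`, with `S` lower unitriangular and `H` diagonal and invertible. -/
structure IsMonicOPS (B : ℝ[X] → ℝ[X] → ℝ) (P : ℕ → ℝ[X]) : Prop where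
  monic : ∀ k, (P k).Monic
  natDegree_eq : ∀ k, (P k).natDegree = k
  orthogonal : ∀ i j, i ≠ j → B (P i) (P j) = 0
  norm_ne_zero : ∀ k, B (P k) (P k) ≠ 0

/-- A linear differential operator `∑_m a_m(x) d^m/dx^m` (finite sum) with coefficient functions
`a_m`, acting on a polynomial `f`; the result is a function. -/
noncomputable def diffOp (a : ℕ →₀ (ℝ → ℝ)) (f : ℝ[X]) (x : ℝ) : ℝ :=
  a.sum fun m am => am x * (derivative^[m] f).eval x

/-- A linear differential operator `∑_m a_m d^m/dx^m` (finite sum) with polynomial coefficients,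
acting on a polynomial. -/
noncomputable def polyDiffOp (a : ℕ →₀ ℝ[X]) (f : ℝ[X]) : ℝ[X] :=
  a.sum fun m am => am * derivative^[m] f

/-- The largest amount by which `∑_m a_m d^m/dx^m` can raise the degree of a polynomial:
`max (0, max_m (deg a_m - m))`, the number of superdiagonals of its matrix in the basis `x^k`. -/
noncomputable def degreeRaise (a : ℕ →₀ ℝ[X]) : ℕ :=
  a.support.sup fun m => (a m).natDegree - m

/-- The polynomial operator `F` satisfies `B(f, h) = ⟨F[f] h, u_γ⟩ = ⟨f F[h], u_γ⟩` for all
polynomials `f`, `h`. -/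
def Represents (c : ClassicalWeight) (F : ℕ →₀ ℝ[X]) (B : ℝ[X] → ℝ[X] → ℝ) : Prop :=
  ∀ f h : ℝ[X],
    B f h = c.pairing (fun x => (polyDiffOp F f).eval x) (fun x => h.eval x) ∧
    B f h = c.pairing (fun x => f.eval x) (fun x => (polyDiffOp F h).eval x)

/-! In the `(i, j)` term of the form, `j` integrations by parts move all derivatives off `h`; the
boundary terms vanish because `W i j` is of type `ω̃` with index `max i j ≥ j`. The Leibniz rule
turns the result into terms `(-1)^j C(j,s) W_ij^(s) f^(i+j-s) h`, and dividing by `u_γ > 0` gives an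
operator of order at most `2n` (`sobolevForm_eq_pairing`). The second equality in `(*)` is the
symmetry of the matrix.

If the `ω` are polynomials, `W i j` carries the factor `p₂ ^ max i j`. By the Pearson equation each
derivative costs one power of `p₂`, so after `s ≤ j` derivatives the quotient by `u_γ` is still a
polynomial (`exists_iteratedDeriv_eq`).

For any representing `F`, both `(F f, h)` and `(f, F h)` equal `⟨F f, F h⟩`. The upper limits of the
expansions are degree bounds. The lower ones come from `⟨F P_k, Pγ_j⟩ = (P_k, Pγ_j)` and `(F P_k,
P_j) = (P_k, F P_j)`, which vanish once the second argument has degree below `k`. -/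

namespace Polynomial

theorem iteratedDeriv_eval (p : ℝ[X]) (m : ℕ) :
    iteratedDeriv m (fun x => p.eval x) = fun x => (derivative^[m] p).eval x := by
  induction m with
  | zero => simp
  | succ m ih =>
    rw [iteratedDeriv_succ, ih, Function.iterate_succ_apply']
    funext x
    exact Polynomial.deriv _

theorem contDiff_eval (p : ℝ[X]) (n : WithTop ℕ∞) : ContDiff ℝ n fun x => p.eval x := by
  simpa using p.contDiff_aeval (𝕜 := ℝ) n

end Polynomial

/-! ### Weights of type `ω̃_k` and integration by parts -/

namespace ClassicalWeight

open MeasureTheory Filter Topology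

variable {c : ClassicalWeight}

theorem isOpen_support (c : ClassicalWeight) : IsOpen c.support := by
  cases c
  · exact isOpen_univ
  · exact isOpen_Ioi
  · exact isOpen_Ioo

theorem support_mem_leftEnd (c : ClassicalWeight) : c.support ∈ c.leftEnd := by
  cases c
  · exact univ_mem
  · exact self_mem_nhdsWithin
  · exact Ioo_mem_nhdsGT (by norm_num)

theorem support_mem_rightEnd (c : ClassicalWeight) : c.support ∈ c.rightEnd := by
  cases c
  · exact univ_mem
  · exact Ioi_mem_atTop 0
  · exact Ioo_mem_nhdsLT (by norm_num)

/-- The integral over `Ω` of a derivative vanishes if the boundary terms do. -/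
theorem integral_deriv_eq_zero {g g' : ℝ → ℝ} (hderiv : ∀ x ∈ c.support, HasDerivAt g (g' x) x)
    (hint : IntegrableOn g' c.support) (hl : Tendsto g c.leftEnd (𝓝 0))
    (hr : Tendsto g c.rightEnd (𝓝 0)) : ∫ x in c.support, g' x = 0 := by
  cases c with
  | hermite =>
    have := integral_of_hasDerivAt_of_tendsto (fun x => hderiv x trivial)
      (integrableOn_univ.1 hint) hl hr
    simpa [support] using this
  | laguerre α =>
    -- Integration by parts against the constant `1` needs only a limit of `g` at the endpoint `0`,
    -- not continuity there.
    have hd : ∀ x ∈ Set.Ioi (0 : ℝ), HasDerivAt (fun _ : ℝ => (1 : ℝ)) 0 x :=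
      fun x _ => hasDerivAt_const x 1
    have h := integral_Ioi_deriv_mul_eq_sub (u := g) (v := fun _ => 1) (v' := fun _ => 0)
      (a := 0) (a' := 0) (b' := 0) (u' := g') hderiv hd
    have e1 : g' * (fun _ : ℝ => (1 : ℝ)) + g * (fun _ => 0) = g' := by
      funext x; simp
    have e2 : g * (fun _ : ℝ => (1 : ℝ)) = g := by
      funext x; simp
    rw [e1, e2] at h
    simpa [support] using h hint hl hr
  | jacobi α β =>
    have hab : (-1 : ℝ) < 1 := by norm_num
    have h := intervalIntegral.integral_eq_sub_of_hasDerivAt_of_tendsto hab hderiv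
      ((intervalIntegrable_iff_integrableOn_Ioo_of_le hab.le).2 hint) hl hr
    rw [intervalIntegral.integral_of_le hab.le, integral_Ioc_eq_integral_Ioo] at h
    simpa [support] using h

namespace IsTildeWeight

variable {k : ℕ} {w : ℝ → ℝ}

theorem contDiffAt (h : c.IsTildeWeight k w) {x : ℝ} (hx : x ∈ c.support) :
    ContDiffAt ℝ k w x :=
  h.contDiffOn.contDiffAt (c.isOpen_support.mem_nhds hx)

theorem continuousOn_iteratedDeriv (h : c.IsTildeWeight k w) {t : ℕ} (ht : t ≤ k) :
    ContinuousOn (iteratedDeriv t w) c.support :=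
  (h.contDiffOn.continuousOn_iteratedDerivWithin (by exact_mod_cast ht)
    c.isOpen_support.uniqueDiffOn).congr
    fun _ hx => (iteratedDerivWithin_of_isOpen c.isOpen_support hx).symm

theorem hasDerivAt_iteratedDeriv (h : c.IsTildeWeight k w) {t : ℕ} (ht : t < k) {x : ℝ}
    (hx : x ∈ c.support) : HasDerivAt (iteratedDeriv t w) (iteratedDeriv (t + 1) w x) x := by
  have h1 := h.contDiffOn.differentiableOn_iteratedDerivWithin (m := t) (by exact_mod_cast ht)
    c.isOpen_support.uniqueDiffOn
  have h2 : DifferentiableOn ℝ (iteratedDeriv t w) c.support := h1.congr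
    fun _ hx => (iteratedDerivWithin_of_isOpen c.isOpen_support hx).symm
  rw [iteratedDeriv_succ]
  exact (h2.differentiableAt (c.isOpen_support.mem_nhds hx)).hasDerivAt

theorem integrableOn_iteratedDeriv_mul_eval (h : c.IsTildeWeight k w) {t : ℕ} (ht : t ≤ k)
    (q : ℝ[X]) : IntegrableOn (fun x => iteratedDeriv t w x * q.eval x) c.support := by
  simp_rw [eval_eq_sum_range, Finset.mul_sum]
  refine integrable_finsetSum _ fun i _ => ?_
  refine ((h.moments t ht i).const_mul (q.coeff i)).congr (ae_of_all _ fun x => ?_)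
  ring

theorem iteratedDeriv_mul_eval (h : c.IsTildeWeight k w) (p : ℝ[X]) {t : ℕ} (ht : t ≤ k) {x : ℝ}
    (hx : x ∈ c.support) :
    iteratedDeriv t (fun y => w y * p.eval y) x = ∑ s ∈ Finset.range (t + 1),
      t.choose s * iteratedDeriv s w x * (derivative^[t - s] p).eval x := by
  have := iteratedDeriv_mul (n := t) (f := w) (g := fun y => p.eval y) (x := x)
    ((h.contDiffAt hx).of_le (by exact_mod_cast ht)) (p.contDiff_eval _).contDiffAt
  simp_rw [iteratedDeriv_eval] at this
  exact this

/-- Weights of type `ω̃_k` are closed under multiplication by polynomials. -/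
theorem mul_eval (h : c.IsTildeWeight k w) (p : ℝ[X]) :
    c.IsTildeWeight k (fun x => w x * p.eval x) where
  contDiffOn := h.contDiffOn.mul (p.contDiff_eval _).contDiffOn
  moments t ht m := by
    -- By Leibniz, derivatives of `w p` are sums of polynomial multiples of derivatives of `w`; the
    -- same sum serves the boundary terms.
    have : IntegrableOn (fun x => ∑ s ∈ Finset.range (t + 1),
        t.choose s * (iteratedDeriv s w x * (derivative^[t - s] p * X ^ m).eval x)) c.support := by
      refine integrable_finsetSum _ fun s hs => (h.integrableOn_iteratedDeriv_mul_eval ?_ _).const_mul _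
      have := Finset.mem_range.1 hs
      omega
    refine this.congr_fun (fun x hx => ?_) c.isOpen_support.measurableSet
    simp only [h.iteratedDeriv_mul_eval p ht hx, Finset.mul_sum, eval_mul, eval_pow, eval_X]
    refine Finset.sum_congr rfl fun s _ => by ring
  boundary_left t ht f := by
    have : Tendsto (fun x => ∑ s ∈ Finset.range (t + 1),
        t.choose s * (iteratedDeriv s w x * (derivative^[t - s] p * f).eval x)) c.leftEnd
        (𝓝 (∑ s ∈ Finset.range (t + 1), t.choose s * 0)) := by
      refine tendsto_finsetSum _ fun s hs => (h.boundary_left s ?_ _).const_mul _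
      have := Finset.mem_range.1 hs
      omega
    simp only [mul_zero, Finset.sum_const_zero] at this
    refine this.congr' (eventually_of_mem c.support_mem_leftEnd fun x hx => ?_)
    simp only [h.iteratedDeriv_mul_eval p ht.le hx, Finset.sum_mul, eval_mul]
    refine Finset.sum_congr rfl fun s _ => by ring
  boundary_right t ht f := by
    have : Tendsto (fun x => ∑ s ∈ Finset.range (t + 1),
        t.choose s * (iteratedDeriv s w x * (derivative^[t - s] p * f).eval x)) c.rightEnd
        (𝓝 (∑ s ∈ Finset.range (t + 1), t.choose s * 0)) := by
      refine tendsto_finsetSum _ fun s hs => (h.boundary_right s ?_ _).const_mul _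
      have := Finset.mem_range.1 hs
      omega
    simp only [mul_zero, Finset.sum_const_zero] at this
    refine this.congr' (eventually_of_mem c.support_mem_rightEnd fun x hx => ?_)
    simp only [h.iteratedDeriv_mul_eval p ht.le hx, Finset.sum_mul, eval_mul]
    refine Finset.sum_congr rfl fun s _ => by ring

/-- One integration by parts per derivative. Passing from `j` to `j + 1` uses only the boundary
terms of `w^(j)`, so vanishing for `t < k` suffices up to `j = k`. -/
theorem integral_iterate_derivative_mul (h : c.IsTildeWeight k w) (p : ℝ[X]) {j : ℕ}
    (hj : j ≤ k) :
    ∫ x in c.support, (derivative^[j] p).eval x * w x =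
      (-1) ^ j * ∫ x in c.support, p.eval x * iteratedDeriv j w x := by
  induction j generalizing p with
  | zero => simp
  | succ j ih =>
    rw [Function.iterate_succ_apply, ih (derivative p) (by omega)]
    have hi (t : ℕ) (ht : t ≤ k) (q : ℝ[X]) :
        IntegrableOn (fun x => q.eval x * iteratedDeriv t w x) c.support := by
      simpa only [mul_comm] using h.integrableOn_iteratedDeriv_mul_eval ht q
    have key := integral_deriv_eq_zero (c := c) (g := fun x => iteratedDeriv j w x * p.eval x)
      (g' := fun x => iteratedDeriv (j + 1) w x * p.eval x +
        iteratedDeriv j w x * (derivative p).eval x)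
      (fun x hx => (h.hasDerivAt_iteratedDeriv (by omega) hx).mul (p.hasDerivAt x))
      ((h.integrableOn_iteratedDeriv_mul_eval hj p).add
        (h.integrableOn_iteratedDeriv_mul_eval (by omega) _))
      (h.boundary_left j (by omega) p) (h.boundary_right j (by omega) p)
    simp_rw [mul_comm (iteratedDeriv _ w _)] at key
    rw [integral_add (hi _ hj _) (hi _ (by omega) _)] at key
    rw [eq_neg_of_add_eq_zero_right key, pow_succ]
    ring

/-- Integration by parts, with the derivatives expanded by the Leibniz rule. -/
theorem integral_iterate_derivative_mul_mul (h : c.IsTildeWeight k w) (p q : ℝ[X]) {j : ℕ}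
    (hj : j ≤ k) :
    ∫ x in c.support, p.eval x * (derivative^[j] q).eval x * w x =
      ∫ x in c.support, (∑ s ∈ Finset.range (j + 1), (-1) ^ j * j.choose s *
        iteratedDeriv s w x * (derivative^[j - s] p).eval x) * q.eval x := by
  -- The factor `p` is absorbed into the weight: `w p` is again of type `ω̃_k`.
  have := (h.mul_eval p).integral_iterate_derivative_mul q hj
  rw [← integral_const_mul] at this
  calc _ = ∫ x in c.support, (derivative^[j] q).eval x * (w x * p.eval x) :=
        integral_congr_ae (ae_of_all _ fun x => by ring)
    _ = _ := this
    _ = _ := by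
      refine setIntegral_congr_fun c.isOpen_support.measurableSet fun x hx => ?_
      simp only [h.iteratedDeriv_mul_eval p hj hx, Finset.mul_sum, Finset.sum_mul]
      exact Finset.sum_congr rfl fun s _ => by ring

theorem integrableOn_leibniz_sum (h : c.IsTildeWeight k w) (p q : ℝ[X]) {j : ℕ} (hj : j ≤ k) :
    IntegrableOn (fun x => (∑ s ∈ Finset.range (j + 1), (-1) ^ j * j.choose s *
        iteratedDeriv s w x * (derivative^[j - s] p).eval x) * q.eval x) c.support := by
  simp_rw [Finset.sum_mul]
  refine integrable_finsetSum _ fun s hs => ?_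
  have hs' := Finset.mem_range.1 hs
  refine ((h.integrableOn_iteratedDeriv_mul_eval (t := s) (by omega)
    (derivative^[j - s] p * q)).const_mul ((-1) ^ j * j.choose s)).congr (ae_of_all _ fun x => ?_)
  simp only [eval_mul]
  ring

end IsTildeWeight

end ClassicalWeight

/-! ### The operator produced by integration by parts, for function and polynomial coefficients
alike -/

/-- The coefficients `∑_{j-s+i=m} (-1)^j C(j,s) A_{ijs}` of the differential operator that
integration by parts produces from a measure matrix. -/
noncomputable def leibnizCoeffs {R : Type*} [CommRing R] (n : ℕ) (A : ℕ → ℕ → ℕ → R) : ℕ →₀ R :=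
  ∑ i ∈ Finset.range (n + 1), ∑ j ∈ Finset.range (n + 1), ∑ s ∈ Finset.range (j + 1),
    Finsupp.single (j - s + i) ((-1) ^ j * (j.choose s : R) * A i j s)

/-- The action of the operator with coefficients `leibnizCoeffs n A`. -/
noncomputable def leibnizOp (n : ℕ) (A : ℕ → ℕ → ℕ → ℝ → ℝ) (f : ℝ[X]) (x : ℝ) : ℝ :=
  ∑ i ∈ Finset.range (n + 1), ∑ j ∈ Finset.range (n + 1), ∑ s ∈ Finset.range (j + 1),
    (-1) ^ j * j.choose s * A i j s x * (derivative^[j - s] (derivative^[i] f)).eval x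

theorem leibnizCoeffs_apply {R : Type*} [CommRing R] (n : ℕ) (A : ℕ → ℕ → ℕ → R) (m : ℕ) :
    leibnizCoeffs n A m = ∑ i ∈ Finset.range (n + 1), ∑ j ∈ Finset.range (n + 1),
      ∑ s ∈ Finset.range (j + 1),
        if j - s + i = m then (-1) ^ j * (j.choose s : R) * A i j s else 0 := by
  simp only [leibnizCoeffs, Finsupp.finsetSum_apply, Finsupp.single_apply]

theorem leibnizCoeffs_apply_eq_zero {R : Type*} [CommRing R] (n : ℕ) (A : ℕ → ℕ → ℕ → R) {m : ℕ}
    (hm : 2 * n < m) : leibnizCoeffs n A m = 0 := by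
  rw [leibnizCoeffs_apply]
  refine Finset.sum_eq_zero fun i hi => Finset.sum_eq_zero fun j hj =>
    Finset.sum_eq_zero fun s _ => if_neg ?_
  have hi' := Finset.mem_range.1 hi
  have hj' := Finset.mem_range.1 hj
  omega

theorem diffOp_add (a b : ℕ →₀ (ℝ → ℝ)) (f : ℝ[X]) (x : ℝ) :
    diffOp (a + b) f x = diffOp a f x + diffOp b f x :=
  Finsupp.sum_add_index' (by simp) (by simp [add_mul])

theorem diffOp_sum {ι : Type*} (S : Finset ι) (a : ι → ℕ →₀ (ℝ → ℝ)) (f : ℝ[X]) (x : ℝ) :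
    diffOp (∑ i ∈ S, a i) f x = ∑ i ∈ S, diffOp (a i) f x :=
  map_sum (AddMonoidHom.mk' (fun a => diffOp a f x) fun a b => diffOp_add a b f x) a S

theorem polyDiffOp_add (a b : ℕ →₀ ℝ[X]) (f : ℝ[X]) :
    polyDiffOp (a + b) f = polyDiffOp a f + polyDiffOp b f :=
  Finsupp.sum_add_index' (by simp) (by simp [add_mul])

theorem polyDiffOp_sum {ι : Type*} (S : Finset ι) (a : ι → ℕ →₀ ℝ[X]) (f : ℝ[X]) :
    polyDiffOp (∑ i ∈ S, a i) f = ∑ i ∈ S, polyDiffOp (a i) f :=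
  map_sum (AddMonoidHom.mk' (fun a => polyDiffOp a f) fun a b => polyDiffOp_add a b f) a S

theorem diffOp_leibnizCoeffs (n : ℕ) (A : ℕ → ℕ → ℕ → ℝ → ℝ) (f : ℝ[X]) (x : ℝ) :
    diffOp (leibnizCoeffs n A) f x = leibnizOp n A f x := by
  simp only [leibnizCoeffs, diffOp_sum, leibnizOp]
  refine Finset.sum_congr rfl fun i _ => Finset.sum_congr rfl fun j _ =>
    Finset.sum_congr rfl fun s _ => ?_
  rw [diffOp, Finsupp.sum_single_index (by simp), Function.iterate_add_apply]
  simp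

theorem eval_polyDiffOp_leibnizCoeffs (n : ℕ) (A : ℕ → ℕ → ℕ → ℝ[X]) (f : ℝ[X]) (x : ℝ) :
    (polyDiffOp (leibnizCoeffs n A) f).eval x =
      leibnizOp n (fun i j s x => (A i j s).eval x) f x := by
  simp only [leibnizCoeffs, polyDiffOp_sum, leibnizOp, eval_finsetSum]
  refine Finset.sum_congr rfl fun i _ => Finset.sum_congr rfl fun j _ =>
    Finset.sum_congr rfl fun s _ => ?_
  rw [polyDiffOp, Finsupp.sum_single_index (by simp), Function.iterate_add_apply]
  simp

/-- An operator raises degrees by at most `degreeRaise`. -/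
theorem natDegree_polyDiffOp_le (F : ℕ →₀ ℝ[X]) (f : ℝ[X]) :
    (polyDiffOp F f).natDegree ≤ f.natDegree + degreeRaise F := by
  refine natDegree_sum_le_of_forall_le _ _ fun m hm => ?_
  have h1 : (F m).natDegree - m ≤ degreeRaise F :=
    Finset.le_sup (f := fun m => (F m).natDegree - m) hm
  -- Terms with `m > deg f` vanish; otherwise `deg f - m` is not truncated and the degrees add up.
  by_cases h : f.natDegree < m
  · simp [iterate_derivative_eq_zero h]
  · have h2 := natDegree_mul_le (p := F m) (q := derivative^[m] f)
    have h3 := natDegree_iterate_derivative f m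
    dsimp only
    omega

/-! ### Expansions in orthogonal polynomials -/

namespace IsMonicOPS

variable {B : ℝ[X] → ℝ[X] → ℝ} {P : ℕ → ℝ[X]}

theorem exists_eq_sum_range (hP : IsMonicOPS B P) (N : ℕ) (Q : ℝ[X]) (hQ : Q.natDegree < N) :
    ∃ a : ℕ → ℝ, Q = ∑ j ∈ Finset.range N, C (a j) * P j := by
  -- With `degree` in place of `natDegree`, the case `N = 0` means `Q = 0`, and the induction can
  -- end there.
  have key : ∀ N : ℕ, ∀ Q : ℝ[X], Q.degree < N →
      ∃ a : ℕ → ℝ, Q = ∑ j ∈ Finset.range N, C (a j) * P j := by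
    intro N
    induction N with
    | zero =>
      intro Q hQ
      exact ⟨0, by simpa using hQ⟩
    | succ N ih =>
      intro Q hQ
      have hd : (Q - C (Q.coeff N) * P N).degree < N := by
        rw [degree_lt_iff_coeff_zero] at hQ ⊢
        intro m hm
        rcases hm.eq_or_lt with rfl | hm
        · have h1 : (P N).coeff N = 1 := by
            have := (hP.monic N).coeff_natDegree
            rwa [hP.natDegree_eq] at this
          simp [h1]
        · have h1 : (P N).coeff m = 0 :=
            coeff_eq_zero_of_natDegree_lt (by rw [hP.natDegree_eq]; exact hm)
          simp [h1, hQ m hm]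
      obtain ⟨a, ha⟩ := ih _ hd
      refine ⟨Function.update a N (Q.coeff N), ?_⟩
      rw [Finset.sum_range_succ, Function.update_self, ← sub_eq_iff_eq_add, ha]
      refine Finset.sum_congr rfl fun j hj => ?_
      rw [Function.update_of_ne (Finset.mem_range.1 hj).ne]
  exact key N Q (degree_le_natDegree.trans_lt (by exact_mod_cast hQ))

theorem apply_sum (hP : IsMonicOPS B P) (hB : ∀ g, IsLinearMap ℝ fun f => B f g) (S : Finset ℕ)
    (a : ℕ → ℝ) (k : ℕ) :
    B (∑ j ∈ S, C (a j) * P j) (P k) = if k ∈ S then a k * B (P k) (P k) else 0 := by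
  have h := map_sum ((hB (P k)).mk' _) (fun j => C (a j) * P j) S
  simp only [IsLinearMap.mk'_apply] at h
  rw [h]
  have h2 : ∀ j, B (C (a j) * P j) (P k) = if k = j then a k * B (P k) (P k) else 0 := by
    intro j
    rw [← smul_eq_C_mul, (hB (P k)).map_smul, smul_eq_mul]
    split_ifs with hjk
    · rw [hjk]
    · rw [hP.orthogonal _ _ (Ne.symm hjk), mul_zero]
  simp_rw [h2]
  exact Finset.sum_ite_eq S k _

theorem apply_eq_zero_of_natDegree_lt (hP : IsMonicOPS B P)
    (hB : ∀ g, IsLinearMap ℝ fun f => B f g) {Q : ℝ[X]} {k : ℕ} (hQ : Q.natDegree < k) :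
    B Q (P k) = 0 := by
  obtain ⟨a, ha⟩ := hP.exists_eq_sum_range k Q hQ
  rw [ha, hP.apply_sum hB]
  simp

/-- The expansion of `Q` in the `P_j` starts at `j = m` if `Q` is orthogonal to all earlier
`P_j`. -/
theorem exists_eq_sum_Icc (hP : IsMonicOPS B P) (hB : ∀ g, IsLinearMap ℝ fun f => B f g)
    {Q : ℝ[X]} {m N : ℕ} (hQ : Q.natDegree ≤ N) (h0 : ∀ j < m, B Q (P j) = 0) :
    ∃ a : ℕ → ℝ, Q = ∑ j ∈ Finset.Icc m N, C (a j) * P j := by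
  obtain ⟨a, ha⟩ := hP.exists_eq_sum_range (N + 1) Q (by omega)
  refine ⟨a, ha.trans (Finset.sum_subset ?_ ?_).symm⟩
  · intro j hj
    have := Finset.mem_Icc.1 hj
    exact Finset.mem_range.2 (by omega)
  · intro j hj hj'
    have hjm : j < m := by
      have := Finset.mem_range.1 hj
      rw [Finset.mem_Icc] at hj'
      omega
    -- Pairing with `P j` reads off `a j` times a nonzero number; positivity of the form plays no
    -- role.
    have h1 := h0 j hjm
    rw [ha, hP.apply_sum hB, if_pos hj] at h1
    simp [(mul_eq_zero.1 h1).resolve_right (hP.norm_ne_zero j)]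

end IsMonicOPS

/-! ### Pearson equation and moments of the classical weights -/

namespace ClassicalWeight

open MeasureTheory Filter Topology

theorem u_pos (c : ClassicalWeight) {x : ℝ} (hx : x ∈ c.support) : 0 < c.u x := by
  cases c with
  | hermite => exact Real.exp_pos _
  | laguerre α => exact mul_pos (Real.rpow_pos_of_pos hx _) (Real.exp_pos _)
  | jacobi α β =>
    exact mul_pos (Real.rpow_pos_of_pos (by linarith [hx.2]) _)
      (Real.rpow_pos_of_pos (by linarith [hx.1]) _)

/-- The polynomial `p₁` of the Pearson equation `p₂ u_γ' = p₁ u_γ`. -/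
noncomputable def p₁ : ClassicalWeight → ℝ[X]
  | hermite => C (-2) * X
  | laguerre α => C α - X
  | jacobi α β => C β * (1 - X) - C α * (1 + X)

/-- The Pearson equation. -/
theorem exists_hasDerivAt_u (c : ClassicalWeight) {x : ℝ} (hx : x ∈ c.support) :
    ∃ d, HasDerivAt c.u d x ∧ c.p₂.eval x * d = c.p₁.eval x * c.u x := by
  cases c with
  | hermite =>
    refine ⟨_, ((hasDerivAt_id x).pow 2).neg.exp, ?_⟩
    simp [p₂, p₁, u]
    ring
  | laguerre α =>
    have hx' : (0 : ℝ) < x := hx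
    refine ⟨_, (Real.hasDerivAt_rpow_const (Or.inl hx'.ne')).mul (hasDerivAt_id x).neg.exp, ?_⟩
    simp only [p₂, p₁, u, Real.rpow_sub_one hx'.ne', eval_X, eval_sub, eval_C]
    simp only [Pi.neg_apply, id]
    field_simp
    ring
  | jacobi α β =>
    have h1 : 0 < 1 - x := by linarith [hx.2]
    have h2 : 0 < 1 + x := by linarith [hx.1]
    refine ⟨_, (((hasDerivAt_id x).const_sub 1).rpow_const (p := α) (Or.inl h1.ne')).mul
      (((hasDerivAt_id x).const_add 1).rpow_const (p := β) (Or.inl h2.ne')), ?_⟩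
    simp only [p₂, p₁, u, id, Real.rpow_sub_one h1.ne', Real.rpow_sub_one h2.ne', eval_X, eval_sub,
      eval_C, eval_mul, eval_add, eval_one, eval_pow]
    field_simp
    ring

theorem continuousOn_u (c : ClassicalWeight) : ContinuousOn c.u c.support := fun _ hx => by
  obtain ⟨d, hd, -⟩ := c.exists_hasDerivAt_u hx
  exact hd.continuousAt.continuousWithinAt

/-- The derivatives up to order `r` of a polynomial multiple of `u_{γ+r}` are polynomial multiples
of `u_γ`. -/
theorem exists_iteratedDeriv_eq (c : ClassicalWeight) {w : ℝ → ℝ} {q : ℝ[X]} {r : ℕ}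
    (hw : ∀ x ∈ c.support, w x = q.eval x * (c.shift r).u x) {t : ℕ} (ht : t ≤ r) :
    ∃ Q : ℝ[X], ∀ x ∈ c.support, Q.eval x * c.u x = iteratedDeriv t w x := by
  -- The induction needs the remaining factor `p₂ ^ (r - t)`: the next derivative consumes one power
  -- of it.
  suffices h : ∃ Q : ℝ[X], ∀ x ∈ c.support,
      iteratedDeriv t w x = (Q * c.p₂ ^ (r - t)).eval x * c.u x by
    obtain ⟨Q, hQ⟩ := h
    exact ⟨_, fun x hx => (hQ x hx).symm⟩
  induction t with
  | zero =>
    refine ⟨q, fun x hx => ?_⟩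
    rw [iteratedDeriv_zero, hw x hx, u_shift c r hx]
    simp only [eval_mul, eval_pow, Nat.sub_zero]
    ring
  | succ t ih =>
    obtain ⟨Q, hQ⟩ := ih (by omega)
    obtain ⟨s, hs⟩ : ∃ s, r - t = s + 1 := ⟨r - t - 1, by omega⟩
    have hs' : r - (t + 1) = s := by omega
    rw [hs] at hQ
    -- This is `(Q p₂^(s+1) u)'` divided by `p₂^s u`, with `p₂ u'` replaced by `p₁ u`.
    refine ⟨derivative Q * c.p₂ + Q * (C (s + 1 : ℝ) * derivative c.p₂ + c.p₁), fun x hx => ?_⟩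
    obtain ⟨d, hd, hp⟩ := c.exists_hasDerivAt_u hx
    have hev : iteratedDeriv t w =ᶠ[𝓝 x] fun y => (Q * c.p₂ ^ (s + 1)).eval y * c.u y :=
      eventually_of_mem (c.isOpen_support.mem_nhds hx) hQ
    have hprod : HasDerivAt (fun y => (Q * c.p₂ ^ (s + 1)).eval y * c.u y) _ x :=
      ((Q * c.p₂ ^ (s + 1)).hasDerivAt x).mul hd
    rw [iteratedDeriv_succ, hev.deriv_eq, hprod.deriv, hs']
    simp only [derivative_mul, derivative_pow_succ, eval_add, eval_mul, eval_pow, eval_C]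
    rw [pow_succ]
    linear_combination (Q.eval x * c.p₂.eval x ^ s) * hp

/-- Split at `0`: on each half only one power can be singular, at its own endpoint, and the other
factors are continuous. -/
theorem integrableOn_eval_mul_u_jacobi {α β : ℝ} (hα : -1 < α) (hβ : -1 < β) (q : ℝ[X]) :
    IntegrableOn (fun x => q.eval x * (jacobi α β).u x) (jacobi α β).support := by
  have hq : Continuous fun x => q.eval x := q.continuous
  have h1 : IntervalIntegrable (fun x : ℝ => q.eval x * ((1 - x) ^ α * (1 + x) ^ β)) volume
      (-1) 0 := by
    have h : IntervalIntegrable (fun x : ℝ => (1 + x) ^ β) volume (-1) 0 := by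
      simpa using (intervalIntegral.intervalIntegrable_rpow' (a := 0) (b := 1) hβ).comp_add_left 1
    refine (h.continuousOn_mul (g := fun x => q.eval x * (1 - x) ^ α) ?_).congr_ae
      (ae_of_all _ fun x => by ring)
    refine hq.continuousOn.mul (ContinuousOn.rpow_const (by fun_prop) fun x hx => Or.inl ?_)
    rw [Set.uIcc_of_le (by norm_num)] at hx
    linarith [hx.2]
  have h2 : IntervalIntegrable (fun x : ℝ => q.eval x * ((1 - x) ^ α * (1 + x) ^ β)) volume
      0 1 := by
    have h : IntervalIntegrable (fun x : ℝ => (1 - x) ^ α) volume 0 1 := by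
      simpa using
        ((intervalIntegral.intervalIntegrable_rpow' (a := 0) (b := 1) hα).comp_sub_left 1).symm
    refine (h.continuousOn_mul (g := fun x => q.eval x * (1 + x) ^ β) ?_).congr_ae
      (ae_of_all _ fun x => by ring)
    refine hq.continuousOn.mul (ContinuousOn.rpow_const (by fun_prop) fun x hx => Or.inl ?_)
    rw [Set.uIcc_of_le (by norm_num)] at hx
    linarith [hx.1]
  exact (intervalIntegrable_iff_integrableOn_Ioo_of_le (by norm_num)).1 (h1.trans h2)

/-- The classical weights have finite moments. -/
theorem integrableOn_eval_mul_u (c : ClassicalWeight) (hc : c.Admissible) (q : ℝ[X]) :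
    IntegrableOn (fun x => q.eval x * c.u x) c.support := by
  have key (h : ∀ m : ℕ, IntegrableOn (fun x => x ^ m * c.u x) c.support) :
      IntegrableOn (fun x => q.eval x * c.u x) c.support := by
    simp_rw [eval_eq_sum_range, Finset.sum_mul]
    refine integrable_finsetSum _ fun i _ => ?_
    simpa only [mul_assoc] using (h i).const_mul (q.coeff i)
  cases c with
  | hermite =>
    refine key fun m => ?_
    have h := integrable_rpow_mul_exp_neg_mul_sq (b := 1) one_pos (s := m)
      (by linarith [Nat.cast_nonneg (α := ℝ) m])
    simpa [support, u] using h
  | laguerre α =>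
    refine key fun m => ?_
    have hα : -1 < α := hc
    -- The `m`-th moment is the integral for `Γ(α + m + 1)`.
    have h := Real.GammaIntegral_convergent (s := α + m + 1)
      (by linarith [Nat.cast_nonneg (α := ℝ) m])
    refine h.congr_fun (fun x hx => ?_) measurableSet_Ioi
    simp only [u, add_sub_cancel_right, Real.rpow_add hx, Real.rpow_natCast]
    ring
  | jacobi α β => exact integrableOn_eval_mul_u_jacobi hc.1 hc.2 q

/-! ### The pairing, the Sobolev form and the passage between them -/

theorem pairing_comm (c : ClassicalWeight) (g₁ g₂ : ℝ → ℝ) :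
    c.pairing g₁ g₂ = c.pairing g₂ g₁ := by
  simp only [pairing, mul_comm]

theorem isLinearMap_pairing (c : ClassicalWeight) (hc : c.Admissible) (g : ℝ[X]) :
    IsLinearMap ℝ fun f : ℝ[X] => c.pairing (fun x => f.eval x) (fun x => g.eval x) where
  map_add f₁ f₂ := by
    have h (f : ℝ[X]) := c.integrableOn_eval_mul_u hc (f * g)
    simp only [eval_mul] at h
    simp only [pairing, eval_add, add_mul]
    exact integral_add (h f₁) (h f₂)
  map_smul a f := by
    simp only [pairing, eval_smul, smul_eq_mul, mul_assoc]
    exact integral_const_mul _ _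

theorem isLinearMap_sobolevForm (c : ClassicalWeight) {n : ℕ} {W : ℕ → ℕ → ℝ → ℝ}
    (hW : ∀ i ≤ n, ∀ j ≤ n, c.IsTildeWeight (max i j) (W i j)) (g : ℝ[X]) :
    IsLinearMap ℝ fun f : ℝ[X] => sobolevForm c.support n W f g where
  map_add f₁ f₂ := by
    simp only [sobolevForm, ← Finset.sum_add_distrib]
    refine Finset.sum_congr rfl fun i hi => Finset.sum_congr rfl fun j hj => ?_
    have hw := hW i (Finset.mem_range_succ_iff.1 hi) j (Finset.mem_range_succ_iff.1 hj)
    have h (f : ℝ[X]) : IntegrableOn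
        (fun x => (derivative^[i] f).eval x * (derivative^[j] g).eval x * W i j x) c.support := by
      have := hw.integrableOn_iteratedDeriv_mul_eval (Nat.zero_le _)
        (derivative^[i] f * derivative^[j] g)
      simpa only [iteratedDeriv_zero, eval_mul, mul_comm (W i j _)] using this
    simp only [iterate_map_add, eval_add, add_mul]
    exact integral_add (h f₁) (h f₂)
  map_smul a f := by
    simp only [sobolevForm, smul_eq_mul, Finset.mul_sum, iterate_derivative_smul, eval_smul,
      mul_assoc, integral_const_mul]

theorem sobolevForm_comm (Ω : Set ℝ) {n : ℕ} {W : ℕ → ℕ → ℝ → ℝ}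
    (hW : ∀ i ≤ n, ∀ j ≤ n, W i j = W j i) (f g : ℝ[X]) :
    sobolevForm Ω n W f g = sobolevForm Ω n W g f := by
  rw [sobolevForm, sobolevForm, Finset.sum_comm]
  refine Finset.sum_congr rfl fun i hi => Finset.sum_congr rfl fun j hj => ?_
  rw [hW j (Finset.mem_range_succ_iff.1 hj) i (Finset.mem_range_succ_iff.1 hi)]
  simp only [mul_comm ((derivative^[j] f).eval _)]

/-- Integration by parts in all terms of the Sobolev form. -/
theorem sobolevForm_eq_pairing (c : ClassicalWeight) {n : ℕ} {W : ℕ → ℕ → ℝ → ℝ}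
    {A : ℕ → ℕ → ℕ → ℝ → ℝ}
    (hW : ∀ i ≤ n, ∀ j ≤ n, c.IsTildeWeight (max i j) (W i j))
    (hA : ∀ i ≤ n, ∀ j ≤ n, ∀ s ≤ j, ∀ x ∈ c.support,
      A i j s x * c.u x = iteratedDeriv s (W i j) x) (f h : ℝ[X]) :
    IntegrableOn (fun x => leibnizOp n A f x * h.eval x * c.u x) c.support ∧
      sobolevForm c.support n W f h = c.pairing (leibnizOp n A f) (fun x => h.eval x) := by
  have hW' : ∀ i ∈ Finset.range (n + 1), ∀ j ∈ Finset.range (n + 1),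
      c.IsTildeWeight (max i j) (W i j) := fun i hi j hj =>
    hW i (Finset.mem_range_succ_iff.1 hi) j (Finset.mem_range_succ_iff.1 hj)
  have hint := fun i hi j hj =>
    (hW' i hi j hj).integrableOn_leibniz_sum (derivative^[i] f) h (le_max_right i j)
  have heq : Set.EqOn (fun x => ∑ i ∈ Finset.range (n + 1), ∑ j ∈ Finset.range (n + 1),
      (∑ s ∈ Finset.range (j + 1), (-1) ^ j * j.choose s * iteratedDeriv s (W i j) x *
        (derivative^[j - s] (derivative^[i] f)).eval x) * h.eval x)
      (fun x => leibnizOp n A f x * h.eval x * c.u x) c.support := by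
    intro x hx
    simp only [leibnizOp, Finset.sum_mul]
    refine Finset.sum_congr rfl fun i hi => Finset.sum_congr rfl fun j hj =>
      Finset.sum_congr rfl fun s hs => ?_
    rw [← hA i (Finset.mem_range_succ_iff.1 hi) j (Finset.mem_range_succ_iff.1 hj) s
      (Finset.mem_range_succ_iff.1 hs) x hx]
    ring
  have hm := c.isOpen_support.measurableSet
  refine ⟨IntegrableOn.congr_fun (integrable_finsetSum _ fun i hi =>
    integrable_finsetSum _ fun j hj => hint i hi j hj) heq hm, ?_⟩
  rw [pairing, ← setIntegral_congr_fun hm heq, integral_finsetSum _ fun i hi =>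
    integrable_finsetSum _ fun j hj => hint i hi j hj, sobolevForm]
  refine Finset.sum_congr rfl fun i hi => ?_
  rw [integral_finsetSum _ fun j hj => hint i hi j hj]
  exact Finset.sum_congr rfl fun j hj =>
    (hW' i hi j hj).integral_iterate_derivative_mul_mul _ _ (le_max_right i j)

/-- Block `r` is supported where `max i j = r`, so a single summand survives; its index is `|i - j|
+ 1`. -/
theorem classicalMeasureMatrix_eq (c : ClassicalWeight) {n : ℕ} (ω : ℕ → ℕ → ℝ → ℝ) {i j : ℕ}
    (hi : i ≤ n) (hj : j ≤ n) :
    classicalMeasureMatrix c n ω i j = fun x =>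
      ω (max i j) (max i j + 1 - min i j) x * (c.shift (max i j)).u x := by
  funext x
  rw [classicalMeasureMatrix, Finset.sum_eq_single (max i j)]
  · rcases le_total i j with h | h
    · simp [coefficientBlock, h]
    · rcases h.eq_or_lt with rfl | h'
      · simp [coefficientBlock]
      · simp [coefficientBlock, h, h'.ne]
  · intro r _ hr
    have h1 : ¬(j = r ∧ i ≤ r) := fun h => hr (by omega)
    have h2 : ¬(i = r ∧ j ≤ r) := fun h => hr (by omega)
    simp [coefficientBlock, h1, h2]
  · intro h
    exact absurd (Finset.mem_range.2 (by omega)) h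

end ClassicalWeight

/-! ### The main theorem -/

open ClassicalWeight

theorem mainTheorem8 (c : ClassicalWeight) (hc : c.Admissible) (n : ℕ)
    (ω : ℕ → ℕ → ℝ → ℝ)
    (hω : ∀ r ≤ n, ∀ j ∈ Finset.Icc 1 (r + 1),
      c.IsTildeWeight r (fun x => ω r j x * (c.shift r).u x)) :
    -- a linear differential operator, with continuous coefficients on the support
    (∃ F : ℕ →₀ (ℝ → ℝ), (∀ m, 2 * n < m → F m = 0) ∧ (∀ m, ContinuousOn (F m) c.support) ∧
      ∀ f h : ℝ[X],
        MeasureTheory.IntegrableOn (fun x => diffOp F f x * h.eval x * c.u x) c.support ∧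
        MeasureTheory.IntegrableOn (fun x => f.eval x * diffOp F h x * c.u x) c.support ∧
        sobolevForm c.support n (classicalMeasureMatrix c n ω) f h =
          c.pairing (diffOp F f) (fun x => h.eval x) ∧
        sobolevForm c.support n (classicalMeasureMatrix c n ω) f h =
          c.pairing (fun x => f.eval x) (diffOp F h)) ∧
    -- if the coefficients of the measure matrix are polynomials, so are those of the operator
    ((∀ r ≤ n, ∀ j ∈ Finset.Icc 1 (r + 1), ∃ q : ℝ[X],
        Set.EqOn (ω r j) (fun x => q.eval x) c.support) →
      ∃ F : ℕ →₀ ℝ[X], (∀ m, 2 * n < m → F m = 0) ∧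
        Represents c F (sobolevForm c.support n (classicalMeasureMatrix c n ω))) ∧
    -- the consequences
    (∀ F : ℕ →₀ ℝ[X],
      Represents c F (sobolevForm c.support n (classicalMeasureMatrix c n ω)) →
      (∀ f h : ℝ[X],
        sobolevForm c.support n (classicalMeasureMatrix c n ω) (polyDiffOp F f) h =
          sobolevForm c.support n (classicalMeasureMatrix c n ω) f (polyDiffOp F h)) ∧
      ∀ P Pγ : ℕ → ℝ[X],
        IsMonicOPS (sobolevForm c.support n (classicalMeasureMatrix c n ω)) P →
        IsMonicOPS (fun f h => c.pairing (fun x => f.eval x) (fun x => h.eval x)) Pγ →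
        (∃ α : ℕ → ℕ → ℝ, ∀ k,
          polyDiffOp F (P k) =
            ∑ j ∈ Finset.Icc k (k + degreeRaise F), C (α k j) * Pγ j) ∧
        ∃ β : ℕ → ℕ → ℝ, ∀ k,
          polyDiffOp F (P k) =
            ∑ j ∈ Finset.Icc (k - degreeRaise F) (k + degreeRaise F), C (β k j) * P j) := by
  set W := classicalMeasureMatrix c n ω with hWdef
  have hmem (i j : ℕ) : max i j + 1 - min i j ∈ Finset.Icc 1 (max i j + 1) :=
    Finset.mem_Icc.2 (by omega)
  have hW : ∀ i ≤ n, ∀ j ≤ n, c.IsTildeWeight (max i j) (W i j) := by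
    intro i hi j hj
    rw [hWdef, classicalMeasureMatrix_eq c ω hi hj]
    exact hω _ (max_le hi hj) _ (hmem i j)
  have hsymm : ∀ f h : ℝ[X], sobolevForm c.support n W f h = sobolevForm c.support n W h f := by
    refine sobolevForm_comm _ fun i hi j hj => ?_
    rw [hWdef, classicalMeasureMatrix_eq c ω hi hj, classicalMeasureMatrix_eq c ω hj hi,
      max_comm, min_comm]
  refine ⟨?_, ?_, ?_⟩
  · have key := sobolevForm_eq_pairing c (A := fun i j s x => iteratedDeriv s (W i j) x / c.u x) hW
      fun i _ j _ s _ x hx => div_mul_cancel₀ _ (c.u_pos hx).ne'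
    refine ⟨leibnizCoeffs n fun i j s x => iteratedDeriv s (W i j) x / c.u x,
      fun m hm => leibnizCoeffs_apply_eq_zero _ _ hm, fun m => ?_, fun f h => ?_⟩
    · rw [leibnizCoeffs_apply]
      have hsum (S : Finset ℕ) (g : ℕ → ℝ → ℝ) (hg : ∀ i ∈ S, ContinuousOn (g i) c.support) :
          ContinuousOn (∑ i ∈ S, g i) c.support :=
        Finset.sum_induction g (fun g => ContinuousOn g c.support) (fun _ _ => ContinuousOn.add)
          continuousOn_const hg
      refine hsum _ _ fun i hi => hsum _ _ fun j hj => hsum _ _ fun s hs => ?_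
      split_ifs
      · have hs' := Finset.mem_range_succ_iff.1 hs
        have hw := hW i (Finset.mem_range_succ_iff.1 hi) j (Finset.mem_range_succ_iff.1 hj)
        exact (continuousOn_const (c := (-1 : ℝ) ^ j * (j.choose s : ℝ))).mul ((hw.continuousOn_iteratedDeriv
          (hs'.trans (le_max_right _ _))).div c.continuousOn_u fun x hx => (c.u_pos hx).ne')
      · exact continuousOn_const
    · have hd (f : ℝ[X]) := funext (diffOp_leibnizCoeffs n
        (fun i j s x => iteratedDeriv s (W i j) x / c.u x) f)
      rw [hd, hd, pairing_comm c (fun x => f.eval x)]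
      refine ⟨(key f h).1, ?_, (key f h).2, (hsymm f h).trans (key h f).2⟩
      simpa only [mul_comm (f.eval _)] using (key h f).1
  · intro hq
    -- The bounds sit inside the existential so that `choose` yields a total family; outside them
    -- the value is `0`.
    have hA : ∀ i j s : ℕ, ∃ Q : ℝ[X], i ≤ n → j ≤ n → s ≤ j → ∀ x ∈ c.support,
        Q.eval x * c.u x = iteratedDeriv s (W i j) x := by
      intro i j s
      by_cases h : i ≤ n ∧ j ≤ n ∧ s ≤ j
      · obtain ⟨hi, hj, hs⟩ := h
        obtain ⟨q, hq⟩ := hq _ (max_le hi hj) _ (hmem i j)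
        obtain ⟨Q, hQ⟩ := exists_iteratedDeriv_eq c (w := W i j) (q := q) (r := max i j) (t := s)
          (fun x hx => by rw [hWdef, classicalMeasureMatrix_eq c ω hi hj]; simp only [hq hx])
          (hs.trans (le_max_right _ _))
        exact ⟨Q, fun _ _ _ => hQ⟩
      · exact ⟨0, fun h1 h2 h3 => absurd ⟨h1, h2, h3⟩ h⟩
    choose A hA using hA
    have key := sobolevForm_eq_pairing c (A := fun i j s x => (A i j s).eval x) hW
      fun i hi j hj s hs x hx => hA i j s hi hj hs x hx
    refine ⟨leibnizCoeffs n A, fun m hm => leibnizCoeffs_apply_eq_zero _ _ hm, fun f h => ?_⟩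
    have hd (f : ℝ[X]) := funext (eval_polyDiffOp_leibnizCoeffs n A f)
    rw [hd, hd, pairing_comm c (fun x => f.eval x)]
    exact ⟨(key f h).2, (hsymm f h).trans (key h f).2⟩
  · intro F hF
    -- Both sides equal `⟨F f, F h⟩`.
    have hself (f h : ℝ[X]) : sobolevForm c.support n W (polyDiffOp F f) h =
        sobolevForm c.support n W f (polyDiffOp F h) :=
      (hF (polyDiffOp F f) h).2.trans (hF f (polyDiffOp F h)).1.symm
    refine ⟨hself, fun P Pγ hP hPγ => ?_⟩
    have hlin := isLinearMap_sobolevForm c hW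
    have hdeg (k : ℕ) : (polyDiffOp F (P k)).natDegree ≤ k + degreeRaise F := by
      simpa only [hP.natDegree_eq] using natDegree_polyDiffOp_le F (P k)
    constructor
    · have hα (k : ℕ) := hPγ.exists_eq_sum_Icc (isLinearMap_pairing c hc) (m := k) (hdeg k)
        fun j hj => by
          -- The pairing becomes the Sobolev product of `P k` with a polynomial of degree `j < k`.
          rw [← (hF (P k) (Pγ j)).1, hsymm]
          exact hP.apply_eq_zero_of_natDegree_lt hlin (by rwa [hPγ.natDegree_eq])
      choose α hα using hα
      exact ⟨α, hα⟩
    · have hβ (k : ℕ) := hP.exists_eq_sum_Icc hlin (m := k - degreeRaise F) (hdeg k)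
        fun j hj => by
          -- `F` moves to `P j`; since `j < k - degreeRaise F`, the degree of `F P_j` stays below
          -- `k`.
          rw [hself, hsymm]
          exact hP.apply_eq_zero_of_natDegree_lt hlin ((hdeg j).trans_lt (by omega))
      choose β hβ using hβ
      exact ⟨β, hβ⟩
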